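/- For a positive integer $m$ let $[m]=\{1,\dots,m\}$. Let $n\ge 1$, and regard a function $f:[n+1]\to[n]$ as a self-map of $[n+1]$ through the inclusion $[n]\subset[n+1]$. The orbit of $x\in[n+1]$ on $f$ is the set $\{x,f(x),f^2(x),\dots\}$, and $x$ is a periodic point of $f$ if $f^k(x)=x$ for some $k\ge 1$. For integers $i,j\ge 0$, let $F_{n,i,j}$ denote the set of functions $f:[n+1]\to[n]$ such that the orbit of $n+1$ on $f$ has exactly $i$ elements and $f$ has exactly $j$ periodic points. Then, for all integers $n\ge1$ and $i,j\ge 0$, $$|F_{n,i+1,j}|=\sum_{s=0}^{\min(i,j)-1}\frac{(i+j-s-1)\,n!}{(n-i-j+s+1)!}\,n^{\,n-i-j+s},$$ where $1/m!$ is read as $0$ for every negative integer $m$, and the sum is empty (equal to $0$) if $\min(i,j)=0$. Consequently, $$|F_{n,i+1,j}|=|F_{n,j+1,i}|.$$ -/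

import Mathlib

namespace OrbitPeriodic

/-- A function `[n+1] → [n]` regarded as a self-map of `[n+1]` through the inclusion
`[n] ⊆ [n+1]`. Here `[n]` is modelled by `Fin n`, and the element `n+1` of `[n+1]` is
`Fin.last n`, the only element outside the range of the inclusion. -/
def selfMap {n : ℕ} (f : Fin (n + 1) → Fin n) : Fin (n + 1) → Fin (n + 1) :=
  fun x => (f x).castSucc

/-- The orbit `{x, f x, f² x, …}` of `x` on `f`. -/
def orbit {n : ℕ} (f : Fin (n + 1) → Fin n) (x : Fin (n + 1)) : Set (Fin (n + 1)) :=
  Set.range fun k : ℕ => (selfMap f)^[k] x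

/-- The set of periodic points of `f`: those `x` with `f^k x = x` for some `k ≥ 1`. -/
def periodicPoints {n : ℕ} (f : Fin (n + 1) → Fin n) : Set (Fin (n + 1)) :=
  Function.periodicPts (selfMap f)

/-- The set `F_{n,i,j}` of functions `[n+1] → [n]` such that the orbit of `n+1` has size `i` and
there are exactly `j` periodic points. -/
def F (n i j : ℕ) : Set (Fin (n + 1) → Fin n) :=
  {f | (orbit f (Fin.last n)).ncard = i ∧ (periodicPoints f).ncard = j}

/-- The reciprocal factorial `1 / m!` of an integer, with the usual convention that it is `0`
for negative `m`. -/
def invFactorial (m : ℤ) : ℚ :=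
  if 0 ≤ m then 1 / (m.toNat.factorial : ℚ) else 0

end OrbitPeriodic

open Function

namespace OrbitPeriodic

/-! A map `[n+1] → [n]` is a point `x` (the image of `n+1`) together with a self-map `g` of `[n]`.
The orbit of `x` has the form `x, …, g^[i-1] x` with `g^[i] x = g^[a] x` for a unique `a < i`.
Redirecting this closing edge to `x` puts `x` on an `i`-cycle and makes the `a` tail points
periodic, reversibly once `a` is known (`card_isRho`). So the count is the sum over `a < i` of the
pointed maps with `x` on an `i`-cycle and `m = j + a` periodic points.

Such a pointed map consists of a set of `m` periodic points, a pointed permutation of it and a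
rooted forest over it. Cycle length is uniform (`card_pointedPerm`): there are `m!` pointed
permutations for every `1 ≤ i ≤ m`. By Cayley (`card_rootedForest`) there are `m * n^(n-m-1)`
forests. The product depends on `i` only through `i ≤ m`, and setting `s = i - 1 - a` gives a sum
symmetric in `i` and `j`. -/

/-! ### Uniformity of cycle lengths in pointed permutations -/

/-- Iterating the permutation of `α` obtained from a permutation `σ` of `Option α` by skipping
`none` follows the iterates of `none` under `σ` until these return to `none`. -/
theorem some_iterate_removeNone {α : Type*} (σ : Equiv.Perm (Option α)) {y : α}
    (hy : σ none = some y) {k : ℕ} (hk : ∀ l, 1 ≤ l → l ≤ k + 1 → σ^[l] none ≠ none) :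
    some ((Equiv.removeNone σ)^[k] y) = σ^[k + 1] none := by
  induction k with
  | zero => simp [hy]
  | succ k ih =>
    have h := ih fun l h1 h2 => hk l h1 (h2.trans (Nat.le_succ _))
    have hne := hk (k + 2) (by omega) le_rfl
    rw [iterate_succ_apply', ← h] at hne
    rw [iterate_succ_apply', iterate_succ_apply' (n := k + 1), ← h]
    obtain ⟨z, hz⟩ := Option.ne_none_iff_exists'.1 hne
    exact Equiv.removeNone_some σ ⟨z, hz⟩

/-- Deleting `none` from its cycle shortens that cycle by one, and `y` is the next point on it. -/
theorem minimalPeriod_none_eq_removeNone {α : Type*} [Finite α] (σ : Equiv.Perm (Option α)) {y : α}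
    (hy : σ none = some y) :
    minimalPeriod σ none = minimalPeriod (Equiv.removeNone σ) y + 1 := by
  set p := minimalPeriod σ none with hp
  set q := minimalPeriod (Equiv.removeNone σ) y with hq
  have hp0 : 0 < p := minimalPeriod_pos_of_mem_periodicPts (σ.injective.mem_periodicPts none)
  have hq0 : 0 < q := minimalPeriod_pos_of_mem_periodicPts
    ((Equiv.removeNone σ).injective.mem_periodicPts y)
  have hpp : σ^[p] none = none := iterate_minimalPeriod
  have hqq : (Equiv.removeNone σ)^[q] y = y := iterate_minimalPeriod
  have hlt : ∀ l, 1 ≤ l → l < p → σ^[l] none ≠ none := fun l h1 h2 h3 =>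
    not_isPeriodicPt_of_pos_of_lt_minimalPeriod (by omega) h2 h3
  have hp1 : p ≠ 1 := fun h => by
    rw [h, iterate_one, hy] at hpp
    simp at hpp
  obtain ⟨r, hr⟩ : ∃ r, p = r + 2 := ⟨p - 2, by omega⟩
  have h1 : some ((Equiv.removeNone σ)^[r] y) = σ^[r + 1] none :=
    some_iterate_removeNone σ hy fun l h1 h2 => hlt l h1 (by omega)
  have h2 : σ (some ((Equiv.removeNone σ)^[r] y)) = none := by
    rw [h1, ← iterate_succ_apply' σ]
    rwa [hr] at hpp
  have h3 : IsPeriodicPt (Equiv.removeNone σ) (r + 1) y := by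
    have := Equiv.removeNone_none σ h2
    rw [hy, Option.some_inj] at this
    rw [IsPeriodicPt, IsFixedPt, iterate_succ_apply', this]
  have h4 : q ≤ r + 1 := h3.minimalPeriod_le (by omega)
  rcases h4.lt_or_eq with h5 | h5
  · exfalso
    -- An earlier return to `y` would give `σ^[q + 1] none = σ none`, hence `σ^[q] none = none` with
    -- `0 < q < p`.
    have h6 := some_iterate_removeNone σ hy (k := q) fun l h1 h2 => hlt l h1 (by omega)
    rw [hqq, ← hy, iterate_succ_apply'] at h6
    exact hlt q hq0 (by omega) (σ.injective h6).symm
  · omega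

/-- Points of `α` paired with permutations in which they have cycle length `i`. -/
abbrev PointedPerm (α : Type*) (i : ℕ) : Type _ :=
  {p : α × Equiv.Perm α // minimalPeriod p.2 p.1 = i}

theorem minimalPeriod_permCongr {α β : Type*} (e : α ≃ β) (σ : Equiv.Perm α) (x : α) :
    minimalPeriod (e.permCongr σ) (e x) = minimalPeriod σ x := by
  have hs : Semiconj e σ (e.permCongr σ) := fun y => by simp
  refine minimalPeriod_eq_minimalPeriod_iff.2 fun n => ?_
  rw [IsPeriodicPt, IsFixedPt, ← (hs.iterate_right n) x, e.injective.eq_iff]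
  rfl

theorem card_pointedPerm_congr {α β : Type*} (e : α ≃ β) (i : ℕ) :
    Nat.card (PointedPerm α i) = Nat.card (PointedPerm β i) :=
  Nat.card_congr <| (e.prodCongr e.permCongr).subtypeEquiv fun p => by
    simp [minimalPeriod_permCongr]

/-- Conjugation by a transposition makes all base points equivalent. -/
theorem card_pointedPerm_eq_mul {α : Type*} [Finite α] (a : α) (i : ℕ) :
    Nat.card (PointedPerm α i) =
      Nat.card α * Nat.card {σ : Equiv.Perm α // minimalPeriod σ a = i} := by
  classical
  have := Fintype.ofFinite α
  rw [Nat.card_congr (Equiv.subtypeProdEquivSigmaSubtype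
    fun (x : α) (σ : Equiv.Perm α) => minimalPeriod σ x = i), Nat.card_sigma]
  rw [Finset.sum_congr rfl fun x _ => show _ =
    Nat.card {σ : Equiv.Perm α // minimalPeriod σ a = i} from ?_]
  · simp
  · refine Nat.card_congr ((Equiv.swap x a).permCongr.subtypeEquiv fun σ => ?_)
    rw [← minimalPeriod_permCongr (Equiv.swap x a) σ x, Equiv.swap_apply_left]

theorem card_perm_option_fixing_none (α : Type*) [Finite α] :
    Nat.card {σ : Equiv.Perm (Option α) // minimalPeriod σ none = 1} = (Nat.card α).factorial := by
  classical
  rw [← Nat.card_perm (α := α)]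
  refine Nat.card_congr (Equiv.ofBijective (fun σ => Equiv.removeNone σ.1) ⟨?_, ?_⟩)
  · rintro ⟨σ, hσ⟩ ⟨τ, hτ⟩ h
    rw [minimalPeriod_eq_one_iff_isFixedPt] at hσ hτ
    exact Subtype.ext (Equiv.Perm.decomposeOption.injective (Prod.ext (hσ.trans hτ.symm) h))
  · intro σ
    refine ⟨⟨Equiv.optionCongr σ, ?_⟩, by simp⟩
    rw [minimalPeriod_eq_one_iff_isFixedPt]
    rfl

/-- Inductive step for uniformity: a permutation moving `none` is recovered from `σ none` and
`removeNone σ`, and the new base point `σ none` lies on a cycle one shorter. -/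
theorem card_perm_option_period_none (α : Type*) [Finite α] {i : ℕ} (hi : 1 ≤ i) :
    Nat.card {σ : Equiv.Perm (Option α) // minimalPeriod σ none = i + 1} =
      Nat.card (PointedPerm α i) := by
  classical
  have key : ∀ σ : Equiv.Perm (Option α), Equiv.Perm.decomposeOption σ = (σ none, Equiv.removeNone σ) :=
    fun σ => rfl
  symm
  refine Nat.card_congr (Equiv.ofBijective
    (fun p => ⟨Equiv.Perm.decomposeOption.symm (some p.1.1, p.1.2), ?_⟩) ⟨?_, ?_⟩)
  · have h := Equiv.Perm.decomposeOption.apply_symm_apply (some p.1.1, p.1.2)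
    rw [key, Prod.mk.injEq] at h
    rw [minimalPeriod_none_eq_removeNone _ h.1, h.2, p.2]
  · rintro ⟨⟨x, σ⟩, hσ⟩ ⟨⟨y, τ⟩, hτ⟩ h
    have h' := Equiv.Perm.decomposeOption.symm.injective (Subtype.ext_iff.1 h)
    simpa using h'
  · rintro ⟨σ, hσ⟩
    have hne : σ none ≠ none := fun h => by
      have : minimalPeriod σ none = 1 := minimalPeriod_eq_one_iff_isFixedPt.2 h
      omega
    obtain ⟨y, hy⟩ := Option.ne_none_iff_exists'.1 hne
    have := minimalPeriod_none_eq_removeNone σ hy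
    refine ⟨⟨(y, Equiv.removeNone σ), by simp only; omega⟩, Subtype.ext ?_⟩
    simp only [Equiv.symm_apply_eq, key, hy]

/-- The cycle length of a point in a permutation is uniformly distributed. -/
theorem card_pointedPerm (m : ℕ) : ∀ {i : ℕ}, 1 ≤ i → i ≤ m →
    Nat.card (PointedPerm (Fin m) i) = m.factorial := by
  induction m with
  | zero => intros; omega
  | succ m ih =>
    intro i h1 h2
    rw [card_pointedPerm_congr (finSuccEquiv m), card_pointedPerm_eq_mul none, Nat.factorial_succ]
    congr 1
    · simp
    · obtain ⟨i, rfl⟩ : ∃ k, i = k + 1 := ⟨i - 1, by omega⟩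
      rcases Nat.eq_zero_or_pos i with rfl | hi
      · simpa using card_perm_option_fixing_none (Fin m)
      · rw [card_perm_option_period_none _ hi, ih hi (by omega)]

/-! ### Decomposition of a self-map into a permutation and a rooted forest -/

/-- An `f`-orbit that enters `M` never leaves it, so a cycle through `y ∉ M` avoids `M` and uses
only values shared with `g`. -/
theorem mem_periodicPts_of_eqOn_compl {V : Type*} {f g : V → V} {M : Set V}
    (hf : Set.MapsTo f M M) (hfg : Set.EqOn f g Mᶜ) {y : V} (hy : y ∉ M)
    (hp : y ∈ Function.periodicPts f) : y ∈ Function.periodicPts g := by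
  obtain ⟨k, hk, hky⟩ := hp
  have hnot : ∀ l, f^[l] y ∉ M := by
    intro l hl
    have h1 : f^[l * k - l] (f^[l] y) ∈ M := hf.iterate _ hl
    rw [← iterate_add_apply, Nat.sub_add_cancel (Nat.le_mul_of_pos_right l hk)] at h1
    exact hy ((hky.const_mul l).eq ▸ h1)
  have hit : ∀ l, g^[l] y = f^[l] y := by
    intro l
    induction l with
    | zero => rfl
    | succ l ih => rw [iterate_succ_apply', iterate_succ_apply', ih, hfg (hnot l)]
  exact ⟨k, hk, (hit k).trans hky⟩

theorem iterate_eq_of_eqOn {V : Type*} {f g : V → V} {M : Set V} (hf : Set.MapsTo f M M)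
    (hfg : Set.EqOn f g M) {x : V} (hx : x ∈ M) (k : ℕ) : f^[k] x = g^[k] x := by
  induction k with
  | zero => rfl
  | succ k ih => rw [iterate_succ_apply', iterate_succ_apply', ← ih, hfg (hf.iterate k hx)]

theorem minimalPeriod_eq_of_eqOn {V : Type*} {f g : V → V} {M : Set V} (hf : Set.MapsTo f M M)
    (hfg : Set.EqOn f g M) {x : V} (hx : x ∈ M) : minimalPeriod f x = minimalPeriod g x :=
  minimalPeriod_eq_minimalPeriod_iff.2 fun k => by
    rw [IsPeriodicPt, IsFixedPt, iterate_eq_of_eqOn hf hfg hx k]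
    rfl

/-- Self-maps of `V` that restrict to the identity on `M` and have no periodic points outside `M`:
rooted forests on `V` with set of roots `M`. -/
abbrev RootedForest {V : Type*} (M : Finset V) : Type _ :=
  {f : V → V // (∀ x ∈ M, f x = x) ∧ Function.periodicPts f = (M : Set V)}

theorem perm_mapsTo_of_fix_compl {V : Type*} {M : Set V} {σ : Equiv.Perm V}
    (h : ∀ x ∉ M, σ x = x) : Set.MapsTo σ M M := by
  intro x hx
  by_contra hn
  rw [σ.injective (h _ hn)] at hn
  exact hn hx

theorem periodicPts_forest_comp_perm {V : Type*} [Finite V] {M : Finset V} (f : RootedForest M)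
    {σ : Equiv.Perm V} (h : ∀ x ∉ M, σ x = x) :
    Function.periodicPts (f.1 ∘ σ) = (M : Set V) := by
  have hσ : Set.MapsTo σ (M : Set V) M := perm_mapsTo_of_fix_compl h
  have he : Set.EqOn (f.1 ∘ σ) σ M := fun x hx => f.2.1 _ (hσ hx)
  have hm : Set.MapsTo (f.1 ∘ σ) (M : Set V) M := hσ.congr he.symm
  ext y
  constructor
  · intro hy
    by_contra hn
    apply hn
    rw [← f.2.2]
    refine mem_periodicPts_of_eqOn_compl hm (fun x hx => ?_) hn hy
    rw [comp_apply, h x hx]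
  · intro hy
    obtain ⟨k, hk, hky⟩ := σ.injective.mem_periodicPts y
    exact ⟨k, hk, (iterate_eq_of_eqOn hm he hy k).trans hky⟩

/-- A self-map with set `M` of periodic points is a permutation of `M` together with a rooted
forest whose roots are the points of `M`. -/
theorem card_periodicPts_eq {V : Type*} [Finite V] (M : Finset V) (C : (V → V) → Prop)
    (hC : ∀ f g : V → V, Set.MapsTo f (M : Set V) M → Set.EqOn f g M → (C f ↔ C g)) :
    Nat.card {f : V → V // Function.periodicPts f = (M : Set V) ∧ C f} =
      Nat.card {σ : Equiv.Perm V // (∀ x ∉ M, σ x = x) ∧ C σ} * Nat.card (RootedForest M) := by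
  classical
  rw [← Nat.card_prod]
  symm
  have heq : ∀ (f : RootedForest M) (σ : Equiv.Perm V), (∀ x ∉ M, σ x = x) →
      Set.EqOn σ (f.1 ∘ σ) M := fun f σ h x hx =>
    (f.2.1 _ (perm_mapsTo_of_fix_compl (M := (M : Set V)) h hx)).symm
  refine Nat.card_congr (Equiv.ofBijective (fun p => ⟨p.2.1 ∘ p.1.1,
    periodicPts_forest_comp_perm p.2 p.1.2.1, ?_⟩) ⟨?_, ?_⟩)
  · exact (hC _ _ (perm_mapsTo_of_fix_compl p.1.2.1) (heq p.2 p.1.1 p.1.2.1)).1 p.1.2.2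
  · rintro ⟨⟨σ, hσ, hσC⟩, f⟩ ⟨⟨τ, hτ, hτC⟩, g⟩ h
    have h' : f.1 ∘ σ = g.1 ∘ τ := Subtype.ext_iff.1 h
    have hστ : σ = τ := by
      ext x
      by_cases hx : x ∈ M
      · rw [heq f σ hσ hx, heq g τ hτ hx, h']
      · rw [hσ x hx, hτ x hx]
    subst hστ
    have hfg : f = g := Subtype.ext (σ.surjective.injective_comp_right h')
    rw [hfg]
  · rintro ⟨f, hf, hfC⟩
    have hb : Set.BijOn f M M := hf ▸ Function.bijOn_periodicPts f
    -- For surjectivity, `σ` is `f` on `M` extended by the identity, and `g` is `f` with the points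
    -- of `M` made fixed.
    let σ : Equiv.Perm V := Equiv.Perm.ofSubtype (p := (· ∈ M)) (hb.equiv f)
    have hσ : ∀ x ∉ M, σ x = x := fun x hx => Equiv.Perm.ofSubtype_apply_of_not_mem _ hx
    have hσf : Set.EqOn f σ M := fun x hx => by
      rw [Equiv.Perm.ofSubtype_apply_of_mem _ hx]; rfl
    let g : V → V := fun x => if x ∈ M then x else f x
    have hgM : ∀ x ∈ M, g x = x := fun x hx => if_pos hx
    have hgf : ∀ x ∉ M, g x = f x := fun x hx => if_neg hx
    have hg : Function.periodicPts g = (M : Set V) := by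
      ext y
      constructor
      · intro hy
        by_contra hn
        apply hn
        rw [← hf]
        refine mem_periodicPts_of_eqOn_compl (fun x hx => ?_) (fun x hx => hgf x hx) hn hy
        rw [hgM x hx]
        exact hx
      · exact fun hy => ⟨1, one_pos, hgM y hy⟩
    refine ⟨(⟨σ, hσ, (hC _ _ hb.mapsTo hσf).1 hfC⟩, ⟨g, hgM, hg⟩), Subtype.ext (funext fun x => ?_)⟩
    by_cases hx : x ∈ M
    · simp only [comp_apply, ← hσf hx]
      exact hgM _ (hb.mapsTo hx)
    · simp only [comp_apply, hσ x hx, hgf x hx]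

/-! ### Cayley's formula for rooted forests -/

theorem card_perm_fix_compl {V : Type*} [Finite V] (S : Finset V) :
    Nat.card {σ : Equiv.Perm V // ∀ x ∉ S, σ x = x} = S.card.factorial := by
  classical
  rw [← Nat.card_congr (Equiv.Perm.subtypeEquivSubtypePerm (· ∈ S)), Nat.card_perm]
  simp

/-- Without its `q = 0` term, the sum for `k + 1` is `k + 1` times the sum for `k` with `r + 1` in
place of `r`. -/
theorem sum_descFactorial_mul_pow (k r : ℕ) :
    ∑ q ∈ Finset.range (k + 1), k.descFactorial q * ((r + q) * (r + k) ^ (k - q)) =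
      (r + k) ^ (k + 1) := by
  induction k generalizing r with
  | zero => simp
  | succ k ih =>
    rw [Finset.sum_range_succ']
    have : ∀ q ∈ Finset.range (k + 1), (k + 1).descFactorial (q + 1) *
        ((r + (q + 1)) * (r + (k + 1)) ^ (k + 1 - (q + 1))) =
        (k + 1) * (k.descFactorial q * ((r + 1 + q) * (r + 1 + k) ^ (k - q))) := by
      intro q _
      rw [Nat.succ_descFactorial_succ, Nat.add_sub_add_right, show r + (q + 1) = r + 1 + q by omega,
        show r + (k + 1) = r + 1 + k by omega]
      ring
    rw [Finset.sum_congr rfl this, ← Finset.mul_sum, ih (r + 1)]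
    simp only [Nat.descFactorial_zero]
    rw [show r + 1 + k = r + (k + 1) by omega]
    simp only [Nat.sub_zero, add_zero]
    ring

theorem card_fix_eq_pow {V : Type*} [Fintype V] (R : Finset V) :
    Nat.card {f : V → V // ∀ x ∈ R, f x = x} =
      Fintype.card V ^ (Fintype.card V - R.card) := by
  classical
  rw [← Finset.card_compl, ← Nat.card_eq_fintype_card, ← Fintype.card_coe, ← Nat.card_eq_fintype_card,
    ← Nat.card_fun]
  refine Nat.card_congr (Equiv.ofBijective (fun f x => f.1 x.1) ⟨?_, ?_⟩)
  · rintro ⟨f, hf⟩ ⟨g, hg⟩ h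
    refine Subtype.ext (funext fun x => ?_)
    by_cases hx : x ∈ R
    · exact (hf x hx).trans (hg x hx).symm
    · exact congrFun h ⟨x, Finset.mem_compl.2 hx⟩
  · intro h
    refine ⟨⟨fun x => if hx : x ∈ R then x else h ⟨x, Finset.mem_compl.2 hx⟩,
      fun x hx => dif_pos hx⟩, funext fun x => ?_⟩
    exact dif_neg (Finset.mem_compl.1 x.2)

theorem card_subtype_eq_sum_fiber {α β : Type*} [Finite α] [Fintype β] (P : α → Prop)
    (r : α → β) : Nat.card {a // P a} = ∑ b, Nat.card {a // r a = b ∧ P a} := by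
  rw [← Nat.card_sigma]
  refine Nat.card_congr ((Equiv.sigmaFiberEquiv fun a : {a // P a} => r a.1).symm.trans
    (Equiv.sigmaCongrRight fun b => ?_))
  exact (Equiv.subtypeSubtypeEquivSubtypeInter P (fun a => r a = b)).trans
    (Equiv.subtypeEquivRight fun a => and_comm)

/-- The finset of periodic points of a self-map of a finite type. -/
noncomputable def periodicFinset {V : Type*} [Finite V] (f : V → V) : Finset V :=
  (Set.toFinite (Function.periodicPts f)).toFinset

theorem periodicFinset_eq_iff {V : Type*} [Finite V] (f : V → V) (M : Finset V) :
    periodicFinset f = M ↔ Function.periodicPts f = (M : Set V) := by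
  rw [← Finset.coe_inj, periodicFinset, Set.Finite.coe_toFinset]

/-- The maps are sorted by their set of periodic points, which contains `R` and so is `R ∪ S`. The
permutation part fixes `R`, hence only permutes `S`. -/
theorem card_fix_eq_sum_forest {V : Type*} [Fintype V] [DecidableEq V] (R : Finset V) :
    Nat.card {f : V → V // ∀ x ∈ R, f x = x} =
      ∑ S ∈ Rᶜ.powerset, S.card.factorial * Nat.card (RootedForest (R ∪ S)) := by
  rw [card_subtype_eq_sum_fiber (fun f : V → V => ∀ x ∈ R, f x = x) periodicFinset]
  symm
  refine Finset.sum_of_injOn (fun S => R ∪ S) ?_ (by simp) ?_ ?_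
  · intro S hS T hT h
    simp only [Finset.coe_powerset, Finset.coe_compl, Set.mem_preimage, Set.mem_powerset_iff] at hS hT
    ext x
    have hx := Finset.ext_iff.1 h x
    simp only [Finset.mem_union] at hx
    have h1 : x ∈ S → x ∉ R := fun h => hS h
    have h2 : x ∈ T → x ∉ R := fun h => hT h
    tauto
  · intro Q _ hQ
    rw [Nat.card_eq_zero]
    left
    refine ⟨fun ⟨f, hf, hR⟩ => hQ ?_⟩
    rw [periodicFinset_eq_iff] at hf
    have hRQ : R ⊆ Q := fun x hx => by
      rw [← Finset.mem_coe, ← hf]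
      exact ⟨1, one_pos, hR x hx⟩
    refine ⟨Q \ R, ?_, Finset.union_sdiff_of_subset hRQ⟩
    simp only [Finset.coe_powerset, Set.mem_preimage, Set.mem_powerset_iff]
    intro x hx
    simp at hx ⊢
    exact hx.2
  · intro S hS
    rw [Finset.mem_powerset] at hS
    simp only [periodicFinset_eq_iff]
    rw [card_periodicPts_eq (R ∪ S) (fun f => ∀ x ∈ R, f x = x), ← card_perm_fix_compl S]
    · congr 1
      refine Nat.card_congr (Equiv.subtypeEquivRight fun σ => ?_)
      constructor
      · intro h
        refine ⟨fun x hx => h x fun hS => hx (Finset.mem_union_right _ hS), fun x hx => h x fun h' => ?_⟩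
        exact Finset.mem_compl.1 (hS h') hx
      · rintro ⟨h1, h2⟩ x hx
        by_cases hR : x ∈ R
        · exact h2 x hR
        · exact h1 x (by simp [hR, hx])
    · intro f g _ hfg
      refine forall₂_congr fun x hx => ?_
      rw [hfg (Finset.mem_coe.2 (Finset.mem_union_left _ hx))]

/-- Cayley's formula for rooted forests: there are `m * n ^ (n - m - 1)` forests on `n` vertices
with a given set of `m` roots. -/
theorem card_rootedForest {V : Type*} [Fintype V] (R : Finset V) :
    Fintype.card V * Nat.card (RootedForest R) =
      R.card * Fintype.card V ^ (Fintype.card V - R.card) := by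
  classical
  induction hk : Fintype.card V - R.card using Nat.strong_induction_on generalizing R with
  | _ k ih =>
    have hRn : R.card ≤ Fintype.card V := R.card_le_univ
    have hn : Fintype.card V = R.card + k := by omega
    have hc : Rᶜ.card = k := by rw [Finset.card_compl, hk]
    have h1 := card_fix_eq_sum_forest R
    rw [card_fix_eq_pow, hk] at h1
    -- The conjectured forest counts satisfy the same recursion as the true ones in `h3`. Only the
    -- `S = ∅` term involves `R` itself; the others agree by induction on the number of non-roots.
    have h2 : ∑ S ∈ Rᶜ.powerset, S.card.factorial *
        ((R.card + S.card) * Fintype.card V ^ (k - S.card)) = Fintype.card V ^ (k + 1) := by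
      rw [Finset.sum_powerset_apply_card
        (fun q => q.factorial * ((R.card + q) * Fintype.card V ^ (k - q))), hc, hn,
        ← sum_descFactorial_mul_pow]
      refine Finset.sum_congr rfl fun q _ => ?_
      rw [Nat.descFactorial_eq_factorial_mul_choose, smul_eq_mul]
      ring
    have h3 : ∑ S ∈ Rᶜ.powerset, S.card.factorial *
        (Fintype.card V * Nat.card (RootedForest (R ∪ S))) = Fintype.card V ^ (k + 1) := by
      rw [pow_succ', h1, Finset.mul_sum]
      exact Finset.sum_congr rfl fun S _ => by ring
    rw [← h2, ← Finset.add_sum_erase _ _ (Finset.empty_mem_powerset _),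
      ← Finset.add_sum_erase (a := ∅) _ _ (Finset.empty_mem_powerset _)] at h3
    rw [Finset.sum_congr rfl (g := fun S : Finset V => S.card.factorial *
        ((R.card + S.card) * Fintype.card V ^ (k - S.card)))] at h3
    · simpa using h3
    · intro S hS
      rw [Finset.mem_erase, Finset.mem_powerset] at hS
      have hd : Disjoint R S := Finset.disjoint_right.2 fun x hx => Finset.mem_compl.1 (hS.2 hx)
      have hS0 : 0 < S.card := Finset.card_pos.2 (Finset.nonempty_iff_ne_empty.2 hS.1)
      have hSk : S.card ≤ k := hc ▸ Finset.card_le_card hS.2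
      have hu := Finset.card_union_of_disjoint hd
      rw [ih (k - S.card) (by omega) (R ∪ S) (by omega), hu]

/-! ### Counting maps with a marked periodic point -/

theorem minimalPeriod_ofSubtype {V : Type*} {p : V → Prop} [DecidablePred p]
    (τ : Equiv.Perm (Subtype p)) (x : Subtype p) :
    minimalPeriod (Equiv.Perm.ofSubtype τ) (x : V) = minimalPeriod τ x := by
  have hs : Semiconj (Subtype.val : Subtype p → V) τ (Equiv.Perm.ofSubtype τ) :=
    fun y => (Equiv.Perm.ofSubtype_apply_coe τ y).symm
  refine minimalPeriod_eq_minimalPeriod_iff.2 fun n => ?_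
  rw [IsPeriodicPt, IsFixedPt, ← (hs.iterate_right n) x, Subtype.val_injective.eq_iff]
  rfl

theorem card_pointedPerm_coe {V : Type*} [Finite V] (M : Finset V) (i : ℕ) :
    Nat.card (PointedPerm M i) =
      ∑ x ∈ M, Nat.card {σ : Equiv.Perm V // (∀ y ∉ M, σ y = y) ∧ minimalPeriod σ x = i} := by
  classical
  rw [Nat.card_congr (Equiv.subtypeProdEquivSigmaSubtype
    fun (x : M) (σ : Equiv.Perm M) => minimalPeriod σ x = i), Nat.card_sigma, ← Finset.sum_coe_sort M]
  refine Finset.sum_congr rfl fun x _ => Nat.card_congr ?_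
  refine ((Equiv.Perm.subtypeEquivSubtypePerm (· ∈ M)).subtypeEquiv fun τ => ?_).trans
    (Equiv.subtypeSubtypeEquivSubtypeInter (fun σ : Equiv.Perm V => ∀ y, y ∉ M → σ y = y)
      (fun σ => minimalPeriod σ (x : V) = i))
  exact (Eq.congr_left (minimalPeriod_ofSubtype τ x)).symm

theorem card_pointed_periodicPts_eq {V : Type*} [Finite V] (M : Finset V) {i : ℕ} (hi : 1 ≤ i) :
    Nat.card {p : V × (V → V) // Function.periodicPts p.2 = (M : Set V) ∧
      minimalPeriod p.2 p.1 = i} = Nat.card (PointedPerm M i) * Nat.card (RootedForest M) := by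
  classical
  have := Fintype.ofFinite V
  rw [Nat.card_congr (Equiv.subtypeProdEquivSigmaSubtype fun (x : V) (f : V → V) =>
    Function.periodicPts f = (M : Set V) ∧ minimalPeriod f x = i), Nat.card_sigma,
    card_pointedPerm_coe, Finset.sum_mul]
  symm
  refine Finset.sum_subset_zero_on_sdiff (Finset.subset_univ M) ?_ ?_
  · intro x hx
    rw [Nat.card_eq_zero]
    left
    refine ⟨fun ⟨f, hf, hx'⟩ => (Finset.mem_sdiff.1 hx).2 ?_⟩
    rw [← Finset.mem_coe, ← hf]
    -- `minimalPeriod` is `0` at non-periodic points, so `1 ≤ i` forces `x` into `M`.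
    exact minimalPeriod_pos_iff_mem_periodicPts.1 (by omega)
  · intro x hx
    exact (card_periodicPts_eq M (fun f => minimalPeriod f x = i) fun f g hf hfg => by
      rw [minimalPeriod_eq_of_eqOn hf hfg hx]).symm

theorem card_pointedPerm_coe_eq {V : Type*} (M : Finset V) {i : ℕ} (hi : 1 ≤ i) :
    Nat.card (PointedPerm M i) = if i ≤ M.card then M.card.factorial else 0 := by
  rw [card_pointedPerm_congr M.equivFin]
  split_ifs with h
  · exact card_pointedPerm _ hi h
  · rw [Nat.card_eq_zero]
    left
    refine ⟨fun ⟨p, hp⟩ => h ?_⟩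
    rw [← hp]
    simpa using minimalPeriod_le_card (f := p.2) (x := p.1)

/-- Pairs of a point of minimal period `i` and a self-map with `m` periodic points. -/
abbrev PointedMap (V : Type*) (i m : ℕ) : Type _ :=
  {p : V × (V → V) // minimalPeriod p.2 p.1 = i ∧ (Function.periodicPts p.2).ncard = m}

/-- Combines the choice of `M`, uniformity of cycle length and Cayley's formula. The factor
`Fintype.card V` avoids the exponent `-1` when `m` equals it. -/
theorem card_pointedMap {V : Type*} [Fintype V] {i : ℕ} (hi : 1 ≤ i) (m : ℕ) :
    Fintype.card V * Nat.card (PointedMap V i m) =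
      if i ≤ m then (Fintype.card V).choose m *
        (m.factorial * (m * Fintype.card V ^ (Fintype.card V - m))) else 0 := by
  classical
  rw [card_subtype_eq_sum_fiber _ (fun p : V × (V → V) => periodicFinset p.2)]
  have key : ∀ M : Finset V, Fintype.card V * Nat.card {p : V × (V → V) // periodicFinset p.2 = M ∧
      minimalPeriod p.2 p.1 = i ∧ (Function.periodicPts p.2).ncard = m} =
      if M.card = m then (if i ≤ m then
        (m.factorial * (m * Fintype.card V ^ (Fintype.card V - m))) else 0) else 0 := by
    intro M
    split_ifs with hM him
    · have h := card_pointed_periodicPts_eq M hi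
      rw [card_pointedPerm_coe_eq M hi, hM, if_pos him] at h
      rw [← hM, ← card_rootedForest M, hM, mul_left_comm, ← h]
      congr 1
      refine Nat.card_congr (Equiv.subtypeEquivRight fun p => ?_)
      rw [periodicFinset_eq_iff]
      refine and_congr_right fun hp => and_iff_left ?_
      rw [hp, Set.ncard_coe_finset, hM]
    · have h := card_pointed_periodicPts_eq M hi
      rw [card_pointedPerm_coe_eq M hi, hM, if_neg him, zero_mul, Nat.card_eq_zero] at h
      rw [mul_eq_zero, Nat.card_eq_zero]
      refine Or.inr (Or.inl ⟨fun p => ?_⟩)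
      rcases h with h | h
      · exact h.false ⟨p.1, (periodicFinset_eq_iff _ _).1 p.2.1, p.2.2.1⟩
      · exact h.not_finite inferInstance
    · rw [mul_eq_zero, Nat.card_eq_zero]
      refine Or.inr (Or.inl ⟨fun p => hM ?_⟩)
      have h := p.2.2.2
      rwa [(periodicFinset_eq_iff _ _).1 p.2.1, Set.ncard_coe_finset] at h
  rw [Finset.mul_sum, Finset.sum_congr rfl fun M _ => key M, ← Finset.sum_filter, Finset.sum_const,
    show (Finset.univ.filter fun M : Finset V => M.card = m) = Finset.univ.powersetCard m by
      ext; simp [Finset.mem_powersetCard]]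
  split_ifs <;> simp

/-! ### Rho-shaped orbits and redirection of the closing edge -/

/-- The orbit of `x` under `f` has `i` elements `x, f x, …, f^[i-1] x`, the last of which is mapped
to `f^[a] x`. -/
def IsRho {V : Type*} (f : V → V) (x : V) (i a : ℕ) : Prop :=
  a < i ∧ Set.InjOn (fun k => f^[k] x) (Set.Iio i) ∧ f^[i] x = f^[a] x

theorem IsRho.iterate_mem_image_Ico {V : Type*} {f : V → V} {x : V} {i a : ℕ}
    (h : IsRho f x i a) {k : ℕ} (hk : a ≤ k) :
    f^[k] x ∈ (fun k => f^[k] x) '' Set.Ico a i := by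
  induction k, hk using Nat.le_induction with
  | base => exact ⟨a, ⟨le_rfl, h.1⟩, rfl⟩
  | succ k _ ih =>
    obtain ⟨l, ⟨h1, h2⟩, hl⟩ := ih
    simp only at hl
    rw [iterate_succ_apply', ← hl, ← iterate_succ_apply' f]
    rcases Nat.lt_or_ge (l + 1) i with h3 | h3
    · exact ⟨l + 1, ⟨by omega, h3⟩, rfl⟩
    · obtain rfl : i = l + 1 := by omega
      exact ⟨a, ⟨le_rfl, h.1⟩, h.2.2.symm⟩

theorem IsRho.range_eq {V : Type*} {f : V → V} {x : V} {i a : ℕ} (h : IsRho f x i a) :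
    (Set.range fun k => f^[k] x) = (fun k => f^[k] x) '' Set.Iio i := by
  refine Set.Subset.antisymm ?_ (Set.image_subset_range _ _)
  rintro _ ⟨k, rfl⟩
  rcases Nat.lt_or_ge k i with hk | hk
  · exact ⟨k, hk, rfl⟩
  · obtain ⟨l, hl, hl'⟩ := h.iterate_mem_image_Ico (h.1.le.trans hk)
    exact ⟨l, hl.2, hl'⟩

theorem IsRho.ncard_range {V : Type*} {f : V → V} {x : V} {i a : ℕ} (h : IsRho f x i a) :
    (Set.range fun k => f^[k] x).ncard = i := by
  rw [h.range_eq, h.2.1.ncard_image, ← Finset.coe_Iio, Set.ncard_coe_finset,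
    Nat.card_Iio]

theorem exists_isRho {V : Type*} [Finite V] (f : V → V) (x : V) : ∃ i a, IsRho f x i a := by
  classical
  -- The orbit size is the first time at which an earlier value recurs.
  have hex : ∃ i, ∃ a, a < i ∧ f^[i] x = f^[a] x := by
    obtain ⟨k, l, hkl, h⟩ := Finite.exists_ne_map_eq_of_infinite fun k : ℕ => f^[k] x
    rcases hkl.lt_or_gt with h' | h'
    · exact ⟨l, k, h', h.symm⟩
    · exact ⟨k, l, h', h⟩
  obtain ⟨a, ha, hfa⟩ := Nat.find_spec hex
  refine ⟨Nat.find hex, a, ha, ?_, hfa⟩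
  intro k hk l hl hkl
  by_contra hne
  rcases Ne.lt_or_gt hne with h' | h'
  · exact Nat.find_min hex hl ⟨k, h', hkl.symm⟩
  · exact Nat.find_min hex hk ⟨l, h', hkl⟩

/-- The periodic points on the orbit are exactly its loop `f^[k] x` with `a ≤ k < i`. -/
theorem IsRho.ncard_periodicPts {V : Type*} [Finite V] {f : V → V} {x : V} {i a : ℕ}
    (h : IsRho f x i a) : (Function.periodicPts f).ncard =
      (Function.periodicPts f \ (fun k => f^[k] x) '' Set.Iio i).ncard + (i - a) := by
  rw [← Set.ncard_inter_add_ncard_sdiff_eq_ncard (Function.periodicPts f)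
    ((fun k => f^[k] x) '' Set.Iio i), add_comm]
  congr 1
  have : Function.periodicPts f ∩ (fun k => f^[k] x) '' Set.Iio i =
      (fun k => f^[k] x) '' Set.Ico a i := by
    ext y
    constructor
    · rintro ⟨⟨q, hq, hy⟩, k, hk, rfl⟩
      -- Going round the cycle `a` times brings the exponent to at least `a`, hence into the loop.
      have h1 : f^[a * q + k] x = f^[k] x := by
        rw [iterate_add_apply]
        exact hy.const_mul a
      have := h.iterate_mem_image_Ico (k := a * q + k)
        ((Nat.le_mul_of_pos_right a hq).trans (Nat.le_add_right _ _))
      rwa [h1] at this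
    · rintro ⟨k, ⟨hk1, hk2⟩, rfl⟩
      refine ⟨⟨i - a, Nat.sub_pos_of_lt h.1, ?_⟩, k, hk2, rfl⟩
      have h1 := h.1
      rw [IsPeriodicPt, IsFixedPt, ← iterate_add_apply, show i - a + k = (k - a) + i by omega,
        iterate_add_apply, h.2.2, ← iterate_add_apply, Nat.sub_add_cancel hk1]
  rw [this, (h.2.1.mono fun k hk => hk.2).ncard_image, ← Finset.coe_Ico,
    Set.ncard_coe_finset, Nat.card_Ico]

/-- Change the image of the last point of the orbit `x, f x, …, f^[i-1] x` to `f^[b] x`. -/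
noncomputable def redirect {V : Type*} (i b : ℕ) (p : V × (V → V)) : V × (V → V) :=
  open Classical in (p.1, update p.2 (p.2^[i - 1] p.1) (p.2^[b] p.1))

theorem redirect_apply_last {V : Type*} (i b : ℕ) (p : V × (V → V)) :
    (redirect i b p).2 (p.2^[i - 1] p.1) = p.2^[b] p.1 := by
  simp [redirect]

theorem redirect_apply_of_ne {V : Type*} {i : ℕ} (b : ℕ) {p : V × (V → V)} {y : V}
    (hy : y ≠ p.2^[i - 1] p.1) : (redirect i b p).2 y = p.2 y := by
  simp [redirect, hy]

theorem IsRho.redirect_iterate {V : Type*} {p : V × (V → V)} {i a : ℕ}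
    (h : IsRho p.2 p.1 i a) (b : ℕ) {k : ℕ} (hk : k < i) :
    (redirect i b p).2^[k] p.1 = p.2^[k] p.1 := by
  induction k with
  | zero => rfl
  | succ k ih =>
    rw [iterate_succ_apply', iterate_succ_apply', ih (by omega)]
    refine redirect_apply_of_ne b fun he => ?_
    have := h.2.1 (show k ∈ Set.Iio i from Nat.lt_of_succ_lt hk)
      (show i - 1 ∈ Set.Iio i from Nat.sub_lt (by omega) one_pos) he
    omega

theorem IsRho.redirect {V : Type*} {p : V × (V → V)} {i a b : ℕ}
    (h : IsRho p.2 p.1 i a) (hb : b < i) :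
    IsRho (redirect i b p).2 (redirect i b p).1 i b := by
  refine ⟨hb, h.2.1.congr fun k hk => (h.redirect_iterate b hk).symm, ?_⟩
  change (OrbitPeriodic.redirect i b p).2^[i] p.1 = (OrbitPeriodic.redirect i b p).2^[b] p.1
  obtain ⟨i, rfl⟩ : ∃ k, i = k + 1 := ⟨i - 1, by omega⟩
  rw [iterate_succ_apply', h.redirect_iterate b (Nat.lt_succ_self i), h.redirect_iterate b hb]
  exact redirect_apply_last (i + 1) b p

theorem IsRho.redirect_redirect {V : Type*} {p : V × (V → V)} {i a b : ℕ}
    (h : IsRho p.2 p.1 i a) : OrbitPeriodic.redirect i a (OrbitPeriodic.redirect i b p) = p := by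
  have ha := h.1
  have hlast : (OrbitPeriodic.redirect i b p).2^[i - 1] (OrbitPeriodic.redirect i b p).1 =
      p.2^[i - 1] p.1 := h.redirect_iterate b (by omega)
  refine Prod.ext rfl (funext fun y => ?_)
  by_cases hy : y = p.2^[i - 1] p.1
  · conv_lhs => rw [hy, ← hlast, redirect_apply_last]
    refine (h.redirect_iterate b h.1).trans ?_
    rw [hy, ← h.2.2, ← iterate_succ_apply' p.2, Nat.succ_eq_add_one, Nat.sub_add_cancel (by omega)]
  · rw [redirect_apply_of_ne _ (by rwa [hlast]), redirect_apply_of_ne _ hy]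

/-- Periodic points off the orbit are unaffected, while the loop length changes from `i - a` to `i -
b`. -/
theorem IsRho.ncard_periodicPts_redirect {V : Type*} [Finite V] {p : V × (V → V)} {i a b : ℕ}
    (h : IsRho p.2 p.1 i a) (hb : b < i) :
    (Function.periodicPts (OrbitPeriodic.redirect i b p).2).ncard + b =
      (Function.periodicPts p.2).ncard + a := by
  have h' := h.redirect hb
  have ha := h.1
  rw [h.ncard_periodicPts, h'.ncard_periodicPts]
  have himg : (fun k => (OrbitPeriodic.redirect i b p).2^[k] (OrbitPeriodic.redirect i b p).1) ''
      Set.Iio i = (fun k => p.2^[k] p.1) '' Set.Iio i :=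
    Set.image_congr fun k hk => h.redirect_iterate b hk
  have hm : ∀ {f : V → V} {x : V} {c : ℕ}, IsRho f x i c →
      Set.MapsTo f ((fun k => f^[k] x) '' Set.Iio i) ((fun k => f^[k] x) '' Set.Iio i) := by
    intro f x c hf
    rw [← hf.range_eq]
    rintro _ ⟨k, rfl⟩
    exact ⟨k + 1, iterate_succ_apply' _ _ _⟩
  have hm' := hm h'
  rw [himg] at hm' ⊢
  have heq : Set.EqOn (OrbitPeriodic.redirect i b p).2 p.2
      ((fun k => p.2^[k] p.1) '' Set.Iio i)ᶜ := by
    intro y hy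
    refine redirect_apply_of_ne b fun he => hy ?_
    exact ⟨i - 1, show i - 1 < i by omega, he.symm⟩
  have hset : Function.periodicPts (OrbitPeriodic.redirect i b p).2 \
      (fun k => p.2^[k] p.1) '' Set.Iio i =
      Function.periodicPts p.2 \ (fun k => p.2^[k] p.1) '' Set.Iio i := by
    ext y
    exact ⟨fun hy => ⟨mem_periodicPts_of_eqOn_compl hm' heq hy.2 hy.1, hy.2⟩,
      fun hy => ⟨mem_periodicPts_of_eqOn_compl (hm h) heq.symm hy.2 hy.1, hy.2⟩⟩
  rw [hset]
  omega

theorem isRho_zero_iff {V : Type*} {f : V → V} {x : V} {i : ℕ} (hi : 1 ≤ i) :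
    IsRho f x i 0 ↔ minimalPeriod f x = i := by
  constructor
  · rintro ⟨_, h1, h2⟩
    have hp : IsPeriodicPt f i x := h2
    have h0 : 0 < minimalPeriod f x := hp.minimalPeriod_pos hi
    by_contra hne
    have hlt : minimalPeriod f x < i := lt_of_le_of_ne (hp.minimalPeriod_le hi) hne
    have := h1 (show minimalPeriod f x ∈ Set.Iio i from hlt) (show 0 ∈ Set.Iio i from hi)
      iterate_minimalPeriod
    omega
  · rintro rfl
    exact ⟨hi, iterate_injOn_Iio_minimalPeriod, iterate_minimalPeriod⟩

/-- Redirecting to `x` and redirecting back to the `a`-th iterate are mutually inverse. -/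
theorem card_isRho {V : Type*} [Finite V] {i a : ℕ} (ha : a < i) (j : ℕ) :
    Nat.card {p : V × (V → V) // IsRho p.2 p.1 i a ∧ (Function.periodicPts p.2).ncard = j} =
      Nat.card (PointedMap V i (j + a)) := by
  have hi : 0 < i := by omega
  refine Nat.card_congr ⟨fun p => ⟨redirect i 0 p.1, ?_, ?_⟩, fun p => ⟨redirect i a p.1, ?_, ?_⟩,
    fun p => Subtype.ext p.2.1.redirect_redirect,
    fun p => Subtype.ext ((isRho_zero_iff hi).2 p.2.1).redirect_redirect⟩
  · exact (isRho_zero_iff hi).1 (p.2.1.redirect hi)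
  · have := p.2.1.ncard_periodicPts_redirect hi
    rw [p.2.2] at this
    omega
  · exact ((isRho_zero_iff hi).2 p.2.1).redirect ha
  · have := ((isRho_zero_iff hi).2 p.2.1).ncard_periodicPts_redirect ha
    rw [p.2.2] at this
    omega

theorem card_orbit_periodicPts {V : Type*} [Finite V] (i j : ℕ) :
    Nat.card {p : V × (V → V) // (Set.range fun k => p.2^[k] p.1).ncard = i ∧
      (Function.periodicPts p.2).ncard = j} =
      ∑ a ∈ Finset.range i, Nat.card (PointedMap V i (j + a)) := by
  rw [← Fin.sum_univ_eq_sum_range (fun a => Nat.card (PointedMap V i (j + a))),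
    Finset.sum_congr rfl fun a _ => (card_isRho a.2 j).symm, ← Nat.card_sigma]
  symm
  refine Nat.card_congr (Equiv.ofBijective
    (fun q => ⟨q.2.1, q.2.2.1.ncard_range, q.2.2.2⟩) ⟨?_, ?_⟩)
  · rintro ⟨a, p, hp, hpj⟩ ⟨b, q, hq, hqj⟩ h
    obtain rfl : p = q := Subtype.ext_iff.1 h
    have hab : a = b := Fin.ext (hp.2.1 (show (a : ℕ) ∈ Set.Iio i from a.2)
      (show (b : ℕ) ∈ Set.Iio i from b.2) (hp.2.2.symm.trans hq.2.2))
    subst hab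
    rfl
  · rintro ⟨p, hp, hpj⟩
    obtain ⟨i', a, h⟩ := exists_isRho p.2 p.1
    obtain rfl : i' = i := h.ncard_range.symm.trans hp
    exact ⟨⟨⟨a, h.1⟩, ⟨p, h, hpj⟩⟩, rfl⟩

/-! ### From maps `[n+1] → [n]` to pointed self-maps, and the final formula -/

theorem iterate_selfMap_castSucc {n : ℕ} (f : Fin (n + 1) → Fin n) (k : ℕ) (x : Fin n) :
    (selfMap f)^[k] x.castSucc = ((f ∘ Fin.castSucc)^[k] x).castSucc :=
  (Semiconj.iterate_right (f := Fin.castSucc) (ga := f ∘ Fin.castSucc) (gb := selfMap f)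
    (fun _ => rfl) k x).symm

theorem ncard_orbit_last {n : ℕ} (f : Fin (n + 1) → Fin n) :
    (orbit f (Fin.last n)).ncard =
      (Set.range fun k => (f ∘ Fin.castSucc)^[k] (f (Fin.last n))).ncard + 1 := by
  have h : orbit f (Fin.last n) = insert (Fin.last n)
      (Fin.castSucc '' Set.range fun k => (f ∘ Fin.castSucc)^[k] (f (Fin.last n))) := by
    have hs : ∀ k, (selfMap f)^[k + 1] (Fin.last n) =
        ((f ∘ Fin.castSucc)^[k] (f (Fin.last n))).castSucc := fun k => by
      rw [iterate_succ_apply, ← iterate_selfMap_castSucc]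
      rfl
    ext y
    constructor
    · rintro ⟨k, rfl⟩
      cases k with
      | zero => exact Or.inl rfl
      | succ k => exact Or.inr ⟨_, ⟨k, rfl⟩, (hs k).symm⟩
    · rintro (rfl | ⟨_, ⟨k, rfl⟩, rfl⟩)
      · exact ⟨0, rfl⟩
      · exact ⟨k + 1, hs k⟩
  rw [h, Set.ncard_insert_of_notMem, Set.ncard_image_of_injective _ (Fin.castSucc_injective n)]
  rintro ⟨y, _, hy⟩
  exact Fin.castSucc_ne_last y hy

theorem ncard_periodicPoints {n : ℕ} (f : Fin (n + 1) → Fin n) :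
    (periodicPoints f).ncard = (Function.periodicPts (f ∘ Fin.castSucc)).ncard := by
  have h : periodicPoints f = Fin.castSucc '' Function.periodicPts (f ∘ Fin.castSucc) := by
    ext y
    constructor
    · rintro ⟨k, hk, hy⟩
      obtain ⟨k, rfl⟩ : ∃ l, k = l + 1 := ⟨k - 1, by omega⟩
      have hy' : (selfMap f)^[k + 1] y = y := hy
      rw [iterate_succ_apply'] at hy'
      -- A periodic point is a value of the map, so it lies in `[n]`.
      obtain ⟨x, rfl⟩ : ∃ x : Fin n, x.castSucc = y := ⟨_, hy'⟩
      refine ⟨x, ⟨k + 1, hk, Fin.castSucc_injective n ?_⟩, rfl⟩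
      rw [← iterate_selfMap_castSucc]
      exact hy
    · rintro ⟨x, ⟨k, hk, hx⟩, rfl⟩
      refine ⟨k, hk, ?_⟩
      rw [IsPeriodicPt, IsFixedPt, iterate_selfMap_castSucc, hx.eq]
  rw [h, Set.ncard_image_of_injective _ (Fin.castSucc_injective n)]

theorem ncard_F_eq_sum (n i j : ℕ) :
    (F n (i + 1) j).ncard = ∑ a ∈ Finset.range i, Nat.card (PointedMap (Fin n) i (j + a)) := by
  rw [← card_orbit_periodicPts, ← Nat.card_coe_set_eq]
  let e : (Fin (n + 1) → Fin n) ≃ Fin n × (Fin n → Fin n) :=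
    ⟨fun f => (f (Fin.last n), f ∘ Fin.castSucc), fun p => Fin.snoc (α := fun _ => Fin n) p.2 p.1,
      fun f => Fin.snoc_init_self f, fun p => Prod.ext (by simp) (funext fun x => by simp)⟩
  refine Nat.card_congr (e.subtypeEquiv fun f => ?_)
  change (orbit f (Fin.last n)).ncard = i + 1 ∧ (periodicPoints f).ncard = j ↔ _
  rw [ncard_orbit_last, ncard_periodicPoints, Nat.add_right_cancel_iff]
  rfl

theorem card_pointedMap_eq {n : ℕ} (hn : 1 ≤ n) {i : ℕ} (hi : 1 ≤ i) {m : ℕ} (him : i ≤ m) :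
    (Nat.card (PointedMap (Fin n) i m) : ℚ) =
      m * ((n.factorial : ℚ) * invFactorial ((n : ℤ) - m)) * (n : ℚ) ^ ((n : ℤ) - m - 1) := by
  have hn0 : (n : ℚ) ≠ 0 := by exact_mod_cast (show n ≠ 0 by omega)
  have h := card_pointedMap (V := Fin n) hi m
  rw [if_pos him, Fintype.card_fin] at h
  have hq := congrArg (Nat.cast : ℕ → ℚ) h
  push_cast at hq
  refine mul_left_cancel₀ hn0 (hq.trans ?_)
  -- For `n < m` both sides vanish, through the binomial and through `invFactorial`.
  rcases Nat.lt_or_ge n m with hnm | hnm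
  · rw [Nat.choose_eq_zero_of_lt hnm, invFactorial, if_neg (by omega)]
    simp
  · have hz : (n : ℤ) - m = ((n - m : ℕ) : ℤ) := by omega
    have hf := Nat.choose_mul_factorial_mul_factorial hnm
    have hf0 : ((n - m).factorial : ℚ) ≠ 0 := by exact_mod_cast (n - m).factorial_ne_zero
    rw [zpow_sub_one₀ hn0, hz, invFactorial, if_pos (by omega), Int.toNat_natCast, zpow_natCast, ← hf]
    push_cast
    field_simp

theorem ncard_F_succ {n : ℕ} (hn : 1 ≤ n) (i j : ℕ) :
    ((F n (i + 1) j).ncard : ℚ) =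
      ∑ s ∈ Finset.range (min i j),
        ((i : ℚ) + j - s - 1) * ((n.factorial : ℚ) *
          invFactorial ((n : ℤ) - i - j + s + 1)) * (n : ℚ) ^ ((n : ℤ) - i - j + s) := by
  rw [ncard_F_eq_sum, ← Finset.sum_range_reflect, Nat.cast_sum]
  symm
  -- With `a = i - 1 - s` one has `m = i + j - s - 1`. The terms with `s ≥ j` have `m < i` and
  -- vanish, since no cycle is longer than the number of periodic points.
  refine Finset.sum_subset_zero_on_sdiff (Finset.range_mono (min_le_left i j)) ?_ ?_
  · intro s hs
    simp only [Finset.mem_sdiff, Finset.mem_range, lt_min_iff] at hs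
    have h := card_pointedMap (V := Fin n) (i := i) (by omega) (j + (i - 1 - s))
    rw [if_neg (by omega), Fintype.card_fin] at h
    exact_mod_cast (Nat.mul_eq_zero.1 h).resolve_left (by omega)
  · intro s hs
    rw [Finset.mem_range, lt_min_iff] at hs
    rw [card_pointedMap_eq hn (by omega) (by omega)]
    have hm : ((j + (i - 1 - s) : ℕ) : ℤ) = (i : ℤ) + j - s - 1 := by omega
    have hm' : ((j + (i - 1 - s) : ℕ) : ℚ) = (i : ℚ) + j - s - 1 := by
      exact_mod_cast congrArg (Int.cast : ℤ → ℚ) hm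
    rw [hm, hm', show (n : ℤ) - ((i : ℤ) + j - s - 1) = n - i - j + s + 1 by ring,
      add_sub_cancel_right]

end OrbitPeriodic

theorem theorem4 (n : ℕ) (hn : 1 ≤ n) (i j : ℕ) :
    ((OrbitPeriodic.F n (i + 1) j).ncard : ℚ) =
        ∑ s ∈ Finset.range (min i j),
          ((i : ℚ) + j - s - 1) * ((n.factorial : ℚ) *
            OrbitPeriodic.invFactorial ((n : ℤ) - i - j + s + 1)) *
              (n : ℚ) ^ ((n : ℤ) - i - j + s) ∧
      (OrbitPeriodic.F n (i + 1) j).ncard = (OrbitPeriodic.F n (j + 1) i).ncard := by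
  refine ⟨OrbitPeriodic.ncard_F_succ hn i j, ?_⟩
  rw [← Nat.cast_inj (R := ℚ), OrbitPeriodic.ncard_F_succ hn, OrbitPeriodic.ncard_F_succ hn,
    min_comm, sub_right_comm, add_comm (i : ℚ)]
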